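/- Theorem 1.3. Setting: let $S$ be a nonempty set and let $\mathcal F$ be a set of finite subsets of $S$ such that $\emptyset\in\mathcal F$, $\{s\}\in\mathcal F$ for every $s\in S$, and $F\cup F'\in\mathcal F$ whenever $F,F'\in\mathcal F$ and $F\cap F'\neq\emptyset$. A set $C\subseteq S$ is connected if for all $x,y\in C$ there is $F\in\mathcal F$ with $F\subseteq C$ and $x,y\in F$; let $\mathcal C$ be the set of connected sets. The pair $(S,\mathcal C)$ is called a connectoid, and it is connected if $S$ is a connected set. For $S'\subseteq S$ let $\mathcal K(S')$ be the set of components of $S'$, i.e. of nonempty maximal connected subsets of $S'$. A necklace is a connected set $N$ for which there are finite connected sets $H_0,H_1,H_2,\dots$ with $N=\bigcup_n H_n$ such that $H_i\cap H_j\neq\emptyset$ if and only if $|i-j|\le 1$. For a finite set $X\subseteq S$, the $X$-tail of $N$ is the unique component in $\mathcal K(N\setminus X)$ that contains all but finitely many elements of $N$. Two necklaces are equivalent if for every finite $X\subseteq S$ their $X$-tails are contained in the same component in $\mathcal K(S\setminus X)$. The ends of $(S,\mathcal C)$ are the equivalence classes of necklaces; $\Omega(S,\mathcal C)$ denotes the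 set of ends. For a finite set $X\subseteq S$ and an end $\omega$, let $K(X,\omega)$ be the component in $\mathcal K(S\setminus X)$ that contains the $X$-tails of all necklaces in $\omega$. A weak normal tree of $(S,\mathcal C)$ is a rooted undirected tree $T$ with $V(T)\subseteq S$ and tree order $\le_T$ such that (a) for every connected set $C$ and every two $\le_T$-incomparable elements $u,v\in C\cap V(T)$ there is $w\in C\cap V(T)$ with $w\le_T u$ and $w\le_T v$, and (b) for all $u\le_T v$ there is a connected set $C$ containing $u$ and $v$ that avoids every $w<_T u$. It is a normal tree if in addition for every ray $R$ in $T$ that starts at the root there is a necklace that contains all but finitely many vertices of $R$. A tree is rayless if it contains no ray. Statement: let $(S,\mathcal C)$ be a connected connectoid with $S\neq\emptyset$, and choose for every end $\omega\in\Omega(S,\mathcal C)$ a finite set $X_\omega\subseteq S$. Then there is a rayless normal tree $T$ of $(S,\mathcal C)$ such that every component in $\mathcal K(S\setminus V(T))$ is a subset of $K(X_\omega,\omega)$ for some $\omega\in\Omega(S,\mathcal C)$. -/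

import Mathlib

/-- A connectoid on the ground set `S`, given by its set `fam` of finite connected sets. -/
structure Connectoid (S : Type*) where
  fam : Set (Set S)
  finite_of_mem : ∀ F ∈ fam, F.Finite
  union_mem : ∀ F ∈ fam, ∀ F' ∈ fam, (F ∩ F').Nonempty → F ∪ F' ∈ fam
  singleton_mem : ∀ s : S, {s} ∈ fam
  empty_mem : ∅ ∈ fam

namespace Connectoid

variable {S : Type*} (C : Connectoid S)

/-- `A` is a connected set of the connectoid. -/
def Conn (A : Set S) : Prop :=
  ∀ x ∈ A, ∀ y ∈ A, ∃ F ∈ C.fam, F ⊆ A ∧ x ∈ F ∧ y ∈ F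

/-- The connectoid is connected if its ground set is a connected set. -/
def IsConnected : Prop := C.Conn Set.univ

/-- The set of components of `A`: its maximal connected subsets.  They are the classes of a
partition of `A`, hence nonempty (this only matters for `A = ∅`, which has no components). -/
def components (A : Set S) : Set (Set S) :=
  {K | K.Nonempty ∧ Maximal (fun B => B ⊆ A ∧ C.Conn B) K}

/-- `H` is a witness that `N` is a necklace. -/
structure IsWitness (N : Set S) (H : ℕ → Set S) : Prop where
  finite : ∀ n, (H n).Finite
  conn : ∀ n, C.Conn (H n)
  eq_iUnion : N = ⋃ n, H n
  inter_iff : ∀ i j : ℕ, (H i ∩ H j).Nonempty ↔ |(i : ℤ) - (j : ℤ)| ≤ 1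

/-- A necklace is a connected set that has a witness. -/
def IsNecklace (N : Set S) : Prop :=
  C.Conn N ∧ ∃ H : ℕ → Set S, C.IsWitness N H

/-- The type of necklaces of the connectoid. -/
def Necklace : Type _ := {N : Set S // C.IsNecklace N}

/-- The `X`-tail of `N`: the component of `N \ X` that contains all but finitely many elements
of `N`.  (For a necklace `N` and a finite set `X` there is exactly one such component, see
`tail_mem` and `tail_unique`.) -/
def tail (N X : Set S) : Set S :=
  ⋃₀ {K | K ∈ C.components (N \ X) ∧ (N \ K).Finite}

/-- Two sets (necklaces) are equivalent if for every finite set `X` their `X`-tails are contained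
in the same component of the complement of `X`. -/
def TailEquiv (N N' : Set S) : Prop :=
  ∀ X : Finset S, ∃ K ∈ C.components (X : Set S)ᶜ, C.tail N X ⊆ K ∧ C.tail N' X ⊆ K

variable {C}

theorem conn_singleton (s : S) : C.Conn {s} := by
  intro x hx y hy
  exact ⟨{s}, C.singleton_mem s, subset_rfl, hx, hy⟩

theorem Conn.union {A B : Set S} (hA : C.Conn A) (hB : C.Conn B) (h : (A ∩ B).Nonempty) :
    C.Conn (A ∪ B) := by
  obtain ⟨z, hzA, hzB⟩ := h
  have key : ∀ x ∈ A ∪ B, ∃ F ∈ C.fam, F ⊆ A ∪ B ∧ x ∈ F ∧ z ∈ F := by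
    rintro x (hx | hx)
    · obtain ⟨F, hF, hFA, h1, h2⟩ := hA x hx z hzA
      exact ⟨F, hF, hFA.trans Set.subset_union_left, h1, h2⟩
    · obtain ⟨F, hF, hFB, h1, h2⟩ := hB x hx z hzB
      exact ⟨F, hF, hFB.trans Set.subset_union_right, h1, h2⟩
  intro x hx y hy
  obtain ⟨F, hF, hFs, h1, h2⟩ := key x hx
  obtain ⟨F', hF', hFs', h1', h2'⟩ := key y hy
  exact ⟨F ∪ F', C.union_mem F hF F' hF' ⟨z, h2, h2'⟩, Set.union_subset hFs hFs',
    Or.inl h1, Or.inr h1'⟩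

theorem conn_of_mem_fam {F : Set S} (hF : F ∈ C.fam) : C.Conn F :=
  fun _ hx _ hy => ⟨F, hF, subset_rfl, hx, hy⟩

theorem conn_of_components {A K : Set S} (hK : K ∈ C.components A) : C.Conn K := hK.2.1.2

theorem subset_of_components {A K : Set S} (hK : K ∈ C.components A) : K ⊆ A := hK.2.1.1

/-- A connected subset of `A` that meets a component of `A` is contained in it. -/
theorem subset_component {A K B : Set S} (hK : K ∈ C.components A) (hB : C.Conn B) (hBA : B ⊆ A)
    (h : (K ∩ B).Nonempty) : B ⊆ K := by
  have h1 : C.Conn (K ∪ B) := (conn_of_components hK).union hB h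
  have h2 : K ∪ B ⊆ K :=
    hK.2.2 ⟨Set.union_subset (subset_of_components hK) hBA, h1⟩ Set.subset_union_left
  exact Set.subset_union_right.trans h2

theorem components_eq {A K K' : Set S} (hK : K ∈ C.components A) (hK' : K' ∈ C.components A)
    (h : (K ∩ K').Nonempty) : K = K' :=
  Set.Subset.antisymm
    (subset_component hK' (conn_of_components hK) (subset_of_components hK)
      (by rwa [Set.inter_comm]))
    (subset_component hK (conn_of_components hK') (subset_of_components hK') h)

/-- Every nonempty connected subset of `A` is contained in a component of `A`. -/
theorem exists_component {A B : Set S} (hB : C.Conn B) (hBA : B ⊆ A) (hne : B.Nonempty) :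
    ∃ K ∈ C.components A, B ⊆ K := by
  obtain ⟨b, hb⟩ := hne
  set K : Set S := ⋃₀ {D | D ⊆ A ∧ C.Conn D ∧ b ∈ D} with hKdef
  have hKA : K ⊆ A := Set.sUnion_subset fun D hD => hD.1
  have hsub : ∀ D : Set S, D ⊆ A → C.Conn D → b ∈ D → D ⊆ K := fun D h1 h2 h3 =>
    Set.subset_sUnion_of_mem (show D ∈ {D | D ⊆ A ∧ C.Conn D ∧ b ∈ D} from ⟨h1, h2, h3⟩)
  have hK : C.Conn K := by
    rintro x ⟨D, ⟨hDA, hD, hbD⟩, hx⟩ y ⟨D', ⟨hDA', hD', hbD'⟩, hy⟩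
    obtain ⟨F, hF, hFs, h1, h2⟩ := hD.union hD' ⟨b, hbD, hbD'⟩ x (Or.inl hx) y (Or.inr hy)
    refine ⟨F, hF, hFs.trans (hsub _ (Set.union_subset hDA hDA') (hD.union hD' ⟨b, hbD, hbD'⟩)
      (Or.inl hbD)), h1, h2⟩
  refine ⟨K, ⟨⟨b, hsub B hBA hB hb hb⟩, ⟨hKA, hK⟩, ?_⟩, hsub B hBA hB hb⟩
  intro D hD hKD
  exact hsub D hD.1 hD.2 (hKD (hsub B hBA hB hb hb))

theorem IsWitness.nonempty {N : Set S} {H : ℕ → Set S} (h : C.IsWitness N H) (n : ℕ) :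
    (H n).Nonempty := by
  have := (h.inter_iff n n).2 (by simp)
  exact this.mono Set.inter_subset_left

/-- Almost all members of a witness avoid a given finite set. -/
theorem IsWitness.eventually_disjoint {N : Set S} {H : ℕ → Set S} (h : C.IsWitness N H)
    {X : Set S} (hX : X.Finite) : ∃ m, ∀ n, m ≤ n → Disjoint (H n) X := by
  induction X, hX using Set.Finite.induction_on with
  | empty => exact ⟨0, fun n _ => by simp⟩
  | @insert a X _ _ ih =>
    obtain ⟨m, hm⟩ := ih
    by_cases ha : ∃ k, a ∈ H k
    · obtain ⟨k, hk⟩ := ha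
      refine ⟨max m (k + 2), fun n hn => ?_⟩
      rw [Set.disjoint_insert_right]
      refine ⟨fun han => ?_, hm n (le_trans (le_max_left _ _) hn)⟩
      have h1 := (h.inter_iff n k).1 ⟨a, han, hk⟩
      have h2 : k + 2 ≤ n := le_trans (le_max_right _ _) hn
      rw [abs_le] at h1
      omega
    · refine ⟨m, fun n hn => ?_⟩
      rw [Set.disjoint_insert_right]
      exact ⟨fun han => ha ⟨n, han⟩, hm n hn⟩

theorem IsWitness.infinite {N : Set S} {H : ℕ → Set S} (h : C.IsWitness N H) : N.Infinite := by
  intro hfin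
  obtain ⟨m, hm⟩ := h.eventually_disjoint hfin
  obtain ⟨x, hx⟩ := h.nonempty m
  refine Set.disjoint_left.1 (hm m le_rfl) hx ?_
  rw [h.eq_iUnion]
  exact Set.mem_iUnion.2 ⟨m, hx⟩

theorem IsWitness.conn_ge {N : Set S} {H : ℕ → Set S} (h : C.IsWitness N H) (m : ℕ) :
    C.Conn (⋃ k, H (m + k)) := by
  have step : ∀ k, ∃ D : Set S, C.Conn D ∧ D ⊆ ⋃ k, H (m + k) ∧ H m ⊆ D ∧ H (m + k) ⊆ D := by
    intro k
    induction k with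
    | zero =>
      exact ⟨H m, h.conn m, Set.subset_iUnion (fun k => H (m + k)) 0, subset_rfl, subset_rfl⟩
    | succ k ih =>
      obtain ⟨D, hD, hDs, h1, h2⟩ := ih
      have hne : (H (m + k) ∩ H (m + (k + 1))).Nonempty :=
        (h.inter_iff _ _).2 (by rw [abs_le]; constructor <;> push_cast <;> omega)
      refine ⟨D ∪ H (m + (k + 1)), hD.union (h.conn _) (hne.mono ?_),
        Set.union_subset hDs (Set.subset_iUnion (fun k => H (m + k)) (k + 1)),
        h1.trans Set.subset_union_left, Set.subset_union_right⟩
      exact Set.inter_subset_inter_left _ h2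
  obtain ⟨z, hz⟩ := h.nonempty m
  intro x hx y hy
  obtain ⟨i, hi⟩ := Set.mem_iUnion.1 hx
  obtain ⟨j, hj⟩ := Set.mem_iUnion.1 hy
  obtain ⟨D, hD, hDs, h1, h2⟩ := step i
  obtain ⟨E, hE, hEs, h3, h4⟩ := step j
  obtain ⟨F, hF, hFs, h5, h6⟩ := hD.union hE ⟨z, h1 hz, h3 hz⟩ x (Or.inl (h2 hi)) y
    (Or.inr (h4 hj))
  exact ⟨F, hF, hFs.trans (Set.union_subset hDs hEs), h5, h6⟩

theorem tail_unique {N X K K' : Set S} (hN : C.IsNecklace N)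
    (hK : K ∈ C.components (N \ X) ∧ (N \ K).Finite)
    (hK' : K' ∈ C.components (N \ X) ∧ (N \ K').Finite) : K = K' := by
  obtain ⟨-, H, hH⟩ := hN
  refine components_eq hK.1 hK'.1 ?_
  by_contra hne
  refine hH.infinite ((hK.2.union hK'.2).subset fun x hx => ?_)
  by_cases h : x ∈ K
  · exact Or.inr ⟨hx, fun h' => hne ⟨x, h, h'⟩⟩
  · exact Or.inl ⟨hx, h⟩

theorem tail_mem {N X : Set S} (hN : C.IsNecklace N) (hX : X.Finite) :
    C.tail N X ∈ C.components (N \ X) ∧ (N \ C.tail N X).Finite := by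
  have hex : ∃ K, K ∈ C.components (N \ X) ∧ (N \ K).Finite := by
    obtain ⟨-, H, hH⟩ := hN
    obtain ⟨m, hm⟩ := hH.eventually_disjoint hX
    have hsub : (⋃ k, H (m + k)) ⊆ N \ X := by
      refine Set.iUnion_subset fun k x hx => ⟨?_, ?_⟩
      · rw [hH.eq_iUnion]
        exact Set.mem_iUnion.2 ⟨_, hx⟩
      · exact Set.disjoint_left.1 (hm (m + k) (Nat.le_add_right _ _)) hx
    have hne : (⋃ k, H (m + k)).Nonempty :=
      (hH.nonempty (m + 0)).mono (Set.subset_iUnion (fun k => H (m + k)) 0)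
    obtain ⟨K, hK, hKs⟩ := exists_component (hH.conn_ge m) hsub hne
    refine ⟨K, hK, ((Set.finite_Iio m).biUnion fun n _ => hH.finite n).subset ?_⟩
    rintro x ⟨hxN, hxK⟩
    rw [hH.eq_iUnion] at hxN
    obtain ⟨n, hn⟩ := Set.mem_iUnion.1 hxN
    refine Set.mem_biUnion (show n ∈ Set.Iio m from ?_) hn
    by_contra hlt
    have hle : m ≤ n := not_lt.1 hlt
    refine hxK (hKs (Set.mem_iUnion.2 ⟨n - m, ?_⟩))
    rwa [Nat.add_sub_cancel' hle]
  obtain ⟨K, hK⟩ := hex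
  have : C.tail N X = K := by
    refine Set.Subset.antisymm (Set.sUnion_subset fun K' hK' => ?_) (Set.subset_sUnion_of_mem hK)
    exact (tail_unique hN hK' hK).subset
  rwa [this]

/-- The tail of a necklace is contained in a component of the complement. -/
theorem exists_component_tail {N : Set S} (hN : C.IsNecklace N) (X : Finset S) :
    ∃ K ∈ C.components (X : Set S)ᶜ, C.tail N X ⊆ K := by
  have h := (tail_mem hN X.finite_toSet).1
  exact exists_component (conn_of_components h) (fun x hx => (subset_of_components h hx).2) h.1

theorem component_tail_unique {N K K' : Set S} (hN : C.IsNecklace N) {X : Finset S}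
    (hK : K ∈ C.components (X : Set S)ᶜ) (hK' : K' ∈ C.components (X : Set S)ᶜ)
    (h : C.tail N X ⊆ K) (h' : C.tail N X ⊆ K') : K = K' := by
  obtain ⟨x, hx⟩ := (tail_mem hN X.finite_toSet).1.1
  exact components_eq hK hK' ⟨x, h hx, h' hx⟩

variable (C)

/-- Equivalence of necklaces. -/
def necklaceSetoid : Setoid C.Necklace where
  r N N' := C.TailEquiv N.1 N'.1
  iseqv :=
    { refl := fun N X => by
        obtain ⟨K, hK, h⟩ := exists_component_tail N.2 X
        exact ⟨K, hK, h, h⟩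
      symm := fun h X => by
        obtain ⟨K, hK, h1, h2⟩ := h X
        exact ⟨K, hK, h2, h1⟩
      trans := fun {_ N' _} h h' X => by
        obtain ⟨K, hK, h1, h2⟩ := h X
        obtain ⟨K', hK', h3, h4⟩ := h' X
        have hE : K = K' := component_tail_unique N'.2 hK hK' h2 h3
        exact ⟨K, hK, h1, hE ▸ h4⟩ }

/-- The ends of the connectoid: the equivalence classes of necklaces. -/
def End : Type _ := Quotient C.necklaceSetoid

/-- `C.endComp X ω` is the component `K(X, ω)` of the complement of `X` that contains the
`X`-tails of all necklaces in `ω` (there is exactly one, see `endComp_spec` and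
`endComp_unique`). -/
def endComp (X : Finset S) (ω : C.End) : Set S :=
  ⋃₀ {K | K ∈ C.components (X : Set S)ᶜ ∧
    ∀ N : C.Necklace, Quotient.mk C.necklaceSetoid N = ω → C.tail N.1 X ⊆ K}

variable {C}

theorem endComp_unique {X : Finset S} {ω : C.End} {K K' : Set S}
    (hK : K ∈ C.components (X : Set S)ᶜ ∧
      ∀ N : C.Necklace, Quotient.mk C.necklaceSetoid N = ω → C.tail N.1 X ⊆ K)
    (hK' : K' ∈ C.components (X : Set S)ᶜ ∧
      ∀ N : C.Necklace, Quotient.mk C.necklaceSetoid N = ω → C.tail N.1 X ⊆ K') : K = K' := by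
  obtain ⟨N, hN⟩ := Quotient.exists_rep ω
  exact component_tail_unique N.2 hK.1 hK'.1 (hK.2 N hN) (hK'.2 N hN)

theorem endComp_spec (X : Finset S) (ω : C.End) :
    C.endComp X ω ∈ C.components (X : Set S)ᶜ ∧
      ∀ N : C.Necklace, Quotient.mk C.necklaceSetoid N = ω → C.tail N.1 X ⊆ C.endComp X ω := by
  obtain ⟨N, hN⟩ := Quotient.exists_rep ω
  obtain ⟨K, hK, hNK⟩ := exists_component_tail N.2 X
  have hall : ∀ N' : C.Necklace, Quotient.mk C.necklaceSetoid N' = ω → C.tail N'.1 X ⊆ K := by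
    intro N' hN'
    have hrel : C.TailEquiv N.1 N'.1 := Quotient.exact (hN.trans hN'.symm)
    obtain ⟨K', hK', h1, h2⟩ := hrel X
    have hE : K = K' := component_tail_unique N.2 hK hK' hNK h1
    exact hE ▸ h2
  have : C.endComp X ω = K :=
    Set.Subset.antisymm (Set.sUnion_subset fun K' hK' => (endComp_unique hK' ⟨hK, hall⟩).subset)
      (Set.subset_sUnion_of_mem ⟨hK, hall⟩)
  rw [this]
  exact ⟨hK, hall⟩

end Connectoid

/-- A rooted (undirected, graph-theoretic) tree whose vertex set is a subset of `S`. -/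
structure RootedTreeOn (S : Type*) where
  verts : Set S
  graph : SimpleGraph verts
  isTree : graph.IsTree
  root : verts

namespace RootedTreeOn

variable {S : Type*} (T : RootedTreeOn S)

/-- The tree order: `u ≤ v` if `u` lies on the path from the root to `v`. -/
def le (u v : T.verts) : Prop :=
  ∃ p : T.graph.Walk T.root v, p.IsPath ∧ u ∈ p.support

/-- `R` enumerates the vertices of a ray (one-way infinite path) of the tree, in order. -/
def IsRay (R : ℕ → T.verts) : Prop :=
  Function.Injective R ∧ ∀ n, T.graph.Adj (R n) (R (n + 1))

/-- The tree contains no ray. -/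
def Rayless : Prop := ∀ R : ℕ → T.verts, ¬ T.IsRay R

end RootedTreeOn

namespace Connectoid

variable {S : Type*} (C : Connectoid S)

/-- Weak normal trees of a connectoid. -/
structure IsWeakNormalTree (T : RootedTreeOn S) : Prop where
  incomparable : ∀ A : Set S, C.Conn A → ∀ u v : T.verts, (u : S) ∈ A → (v : S) ∈ A →
    ¬ T.le u v → ¬ T.le v u → ∃ w : T.verts, (w : S) ∈ A ∧ T.le w u ∧ T.le w v
  comparable : ∀ u v : T.verts, T.le u v → ∃ A : Set S, C.Conn A ∧ (u : S) ∈ A ∧ (v : S) ∈ A ∧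
    ∀ w : T.verts, T.le w u → w ≠ u → (w : S) ∉ A

/-- Normal trees of a connectoid: weak normal trees in which every rooted ray has almost all of
its vertices in a common necklace. -/
structure IsNormalTree (T : RootedTreeOn S) : Prop extends C.IsWeakNormalTree T where
  ray : ∀ R : ℕ → T.verts, T.IsRay R → R 0 = T.root →
    ∃ N : Set S, C.IsNecklace N ∧ (Set.range (fun n => (R n : S)) \ N).Finite

end Connectoid

/-! Call a set dismantlable if deleting single elements, and continuing separately in every
component, breaks it up without infinite descent into sets each contained in some K(X_ω, ω). If the
ground set is dismantlable, a rule `σ` naming the next deletion arranges the deleted elements in a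
tree. Well-foundedness makes the tree rayless, so the necklace condition is vacuous, and a connected
set avoiding all deleted elements ends up inside one of the final pieces.

If the ground set were not dismantlable, the nonempty connected non-dismantlable sets would satisfy
the hypotheses of `exists_end_forall_endComp`. Some end ω would then have K(Y, ω) non-dismantlable
for every finite Y, which is absurd for Y = X_ω.

That lemma is the core. Repeated finite deletion yields a necklace (`exists_descending_seq`), but
its end must be tied to members of `B`. Either every member contains fat finite sets of all orders,
and the necklace is threaded through them, or some point `b` has separators that can be chosen
pairwise disjoint inside a member `E`. Deleting those drives the descending members away from every
finite set. -/

namespace Connectoid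

variable {S : Type*} {C : Connectoid S}

/-! ### Necklaces and ends from successive finite deletions -/

/-- Finitely many elements of a connected set lie in a common finite connected subset. -/
theorem Conn.exists_finite_superset {D : Set S} (hD : C.Conn D) {B : Set S} (hB : B.Finite)
    (hBD : B ⊆ D) : ∃ F : Set S, F.Finite ∧ C.Conn F ∧ B ⊆ F ∧ F ⊆ D := by
  induction B, hB using Set.Finite.induction_on with
  | empty => exact ⟨∅, Set.finite_empty, fun x hx => hx.elim, subset_rfl, Set.empty_subset _⟩
  | @insert a B _ _ ih =>
    obtain ⟨F, hF, hFc, hBF, hFD⟩ := ih ((Set.subset_insert a B).trans hBD)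
    have ha : a ∈ D := hBD (Set.mem_insert a B)
    rcases F.eq_empty_or_nonempty with rfl | ⟨x, hx⟩
    · refine ⟨{a}, Set.finite_singleton a, conn_singleton a, ?_, Set.singleton_subset_iff.2 ha⟩
      rintro y (rfl | hy)
      · rfl
      · exact (hBF hy).elim
    · obtain ⟨G, hG, hGD, haG, hxG⟩ := hD a ha x (hFD hx)
      refine ⟨F ∪ G, hF.union (C.finite_of_mem G hG), hFc.union (conn_of_mem_fam hG) ⟨x, hx, hxG⟩,
        Set.insert_subset (Or.inr haG) (hBF.trans Set.subset_union_left), Set.union_subset hFD hGD⟩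

/-- A witness determines an end, and almost all members of the witness lie in the component in
which that end lives. -/
theorem IsWitness.exists_end {N : Set S} {H : ℕ → Set S} (h : C.IsWitness N H) :
    ∃ ω : C.End, ∀ Y : Finset S, ∃ m, ∀ n, m ≤ n → H n ⊆ C.endComp Y ω := by
  have hN : C.Conn N := by
    have := h.conn_ge 0
    simp only [Nat.zero_add] at this
    rwa [h.eq_iUnion]
  let N' : C.Necklace := ⟨N, hN, H, h⟩
  refine ⟨Quotient.mk C.necklaceSetoid N', fun Y => ?_⟩
  obtain ⟨m, hm⟩ := h.eventually_disjoint (tail_mem N'.2 Y.finite_toSet).2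
  refine ⟨m, fun n hn x hx => (endComp_spec Y _).2 N' rfl ?_⟩
  by_contra hxt
  refine Set.disjoint_left.1 (hm n hn) hx ⟨?_, hxt⟩
  change x ∈ N
  rw [h.eq_iUnion]
  exact Set.mem_iUnion.2 ⟨n, hx⟩

variable {B : Set S → Prop}

/-- Fix a class of connected sets such that after deleting finitely many elements from a member
some component is again a member.  Deleting successively finite sets prescribed by `α`, one can
choose the members so that the deleted sets converge to an end. -/
theorem exists_descending_seq (hconn : ∀ D, B D → C.Conn D)
    (hsplit : ∀ D, B D → ∀ Y : Set S, Y.Finite → ∃ K ∈ C.components (D \ Y), B K)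
    (α : ℕ → Set S → Set S)
    (hα : ∀ n D, B D → (α n D).Finite ∧ (α n D).Nonempty ∧ α n D ⊆ D) {D₀ : Set S} (h₀ : B D₀) :
    ∃ D : ℕ → Set S, (∀ n, B (D n)) ∧ (∀ n, D n ⊆ D₀) ∧ (∀ n, D (n + 1) ⊆ D n \ α n (D n)) ∧
      ∃ ω : C.End, ∀ Y : Finset S, ∃ m, ∀ n, m ≤ n → α n (D n) ⊆ C.endComp Y ω := by
  choose! f hfc hfB using hsplit
  have hlink : ∀ D A : Set S, B D → A.Finite → A ⊆ D →
      ∃ F : Set S, F.Finite ∧ C.Conn F ∧ A ⊆ F ∧ F ⊆ D :=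
    fun D A hD hA hAD => (hconn D hD).exists_finite_superset hA hAD
  choose! g hgf hgc hgA hgD using hlink
  -- The second entry is the finite set to delete next. The link between consecutive prescribed sets
  -- depends on the new member, so it is deleted one step late; hence links are disjoint only from
  -- index distance 2 on, as a witness requires.
  let next : ℕ → Set S × Set S → Set S × Set S := fun n p =>
    (f p.1 p.2, α (n + 1) (f p.1 p.2) ∪ g p.1 (α n p.1 ∪ α (n + 1) (f p.1 p.2)))
  let st : ℕ → Set S × Set S := fun n => Nat.rec (D₀, α 0 D₀) next n
  have hst : ∀ n, B (st n).1 ∧ (st n).2.Finite ∧ α n (st n).1 ⊆ (st n).2 := by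
    intro n
    induction n with
    | zero => exact ⟨h₀, (hα 0 D₀ h₀).1, subset_rfl⟩
    | succ n ih =>
      obtain ⟨h1, h2, h3⟩ := ih
      have h4 : B (f (st n).1 (st n).2) := hfB _ h1 _ h2
      have h5 : f (st n).1 (st n).2 ⊆ (st n).1 := (subset_of_components (hfc _ h1 _ h2)).trans
        Set.sdiff_subset
      refine ⟨h4, (hα _ _ h4).1.union (hgf _ _ h1 ((hα _ _ h1).1.union (hα _ _ h4).1) ?_),
        Set.subset_union_left⟩
      exact Set.union_subset (hα _ _ h1).2.2 ((hα _ _ h4).2.2.trans h5)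
  set D : ℕ → Set S := fun n => (st n).1 with hDdef
  have hB : ∀ n, B (D n) := fun n => (hst n).1
  have hstep : ∀ n, D (n + 1) ⊆ D n \ (st n).2 := fun n =>
    subset_of_components (hfc _ (hst n).1 _ (hst n).2.1)
  have hanti : Antitone D := antitone_nat_of_succ_le fun n => (hstep n).trans Set.sdiff_subset
  let H : ℕ → Set S := fun n => g (D n) (α n (D n) ∪ α (n + 1) (D (n + 1)))
  have hpre : ∀ n, (α n (D n) ∪ α (n + 1) (D (n + 1))).Finite ∧
      α n (D n) ∪ α (n + 1) (D (n + 1)) ⊆ D n := fun n =>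
    ⟨(hα _ _ (hB n)).1.union (hα _ _ (hB (n + 1))).1, Set.union_subset (hα _ _ (hB n)).2.2
      ((hα _ _ (hB _)).2.2.trans (hanti n.le_succ))⟩
  have hHA : ∀ n, α n (D n) ∪ α (n + 1) (D (n + 1)) ⊆ H n := fun n =>
    hgA _ _ (hB n) (hpre n).1 (hpre n).2
  have hHD : ∀ n, H n ⊆ D n := fun n => hgD _ _ (hB n) (hpre n).1 (hpre n).2
  have hHdisj : ∀ n k, n + 2 ≤ k → Disjoint (H n) (H k) := by
    intro n k hk
    rw [Set.disjoint_left]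
    intro x hx hxk
    have h1 : x ∈ D (n + 1 + 1) := hanti hk (hHD k hxk)
    exact (hstep (n + 1) h1).2 (Or.inr hx)
  have hW : C.IsWitness (⋃ n, H n) H := by
    refine ⟨fun n => hgf _ _ (hB n) (hpre n).1 (hpre n).2,
      fun n => hgc _ _ (hB n) (hpre n).1 (hpre n).2, rfl, fun i j => ⟨?_, ?_⟩⟩
    · rintro ⟨x, hxi, hxj⟩
      by_contra hij
      rw [abs_le] at hij
      rcases le_or_gt (i + 2) j with h | h
      · exact Set.disjoint_left.1 (hHdisj i j h) hxi hxj
      · exact Set.disjoint_left.1 (hHdisj j i (by omega)) hxj hxi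
    · have hself : ∀ n, (H n).Nonempty := fun n =>
        (hα _ _ (hB n)).2.1.mono (Set.subset_union_left.trans (hHA n))
      have hsucc : ∀ n, (H n ∩ H (n + 1)).Nonempty := fun n =>
        (hα _ _ (hB (n + 1))).2.1.mono (Set.subset_inter (Set.subset_union_right.trans (hHA n))
          (Set.subset_union_left.trans (hHA (n + 1))))
      intro hij
      rw [abs_le] at hij
      obtain rfl | rfl | rfl : i = j ∨ j = i + 1 ∨ i = j + 1 := by omega
      · rw [Set.inter_self]; exact hself i
      · exact hsucc i
      · rw [Set.inter_comm]; exact hsucc j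
  obtain ⟨ω, hω⟩ := hW.exists_end
  refine ⟨D, hB, fun n => hanti n.zero_le, fun n => (hstep n).trans
    (Set.sdiff_subset_sdiff_right (hst n).2.2), ω, fun Y => ?_⟩
  obtain ⟨m, hm⟩ := hω Y
  exact ⟨m, fun n hn => Set.subset_union_left.trans ((hHA n).trans (hm n hn))⟩

/-! ### An end all of whose components lie in a given class -/

/-- The finite sets that meet, for every set `Z` of at most `p` elements, some component of
`D \ Z` that lies in the class `B`. -/
def Fat (C : Connectoid S) (B : Set S → Prop) (p : ℕ) (D : Set S) (A : Finset S) : Prop :=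
  ∀ Z : Finset S, Z.card ≤ p → ∃ K ∈ C.components (D \ Z), B K ∧ (K ∩ A).Nonempty

/-- If every member of `B` has fat subsets of all orders, some end lives in members of `B` only. -/
theorem exists_end_of_fat (hconn : ∀ D, B D → C.Conn D)
    (hmono : ∀ D D', B D → D ⊆ D' → C.Conn D' → B D')
    (hsplit : ∀ D, B D → ∀ Y : Set S, Y.Finite → ∃ K ∈ C.components (D \ Y), B K)
    (hfat : ∀ p D, B D → ∃ A : Finset S, C.Fat B p D A) {D₀ : Set S} (h₀ : B D₀) :
    ∃ ω : C.End, ∀ Y : Finset S, B (C.endComp Y ω) := by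
  choose! A hA using hfat
  obtain ⟨D, hB, -, -, ω, hω⟩ := exists_descending_seq hconn hsplit (fun n D => ↑(A n D) ∩ D)
    (fun n D hD => by
      obtain ⟨K, hK, -, x, hxK, hxA⟩ := hA n D hD ∅ (Nat.zero_le _)
      exact ⟨(A n D).finite_toSet.inter_of_left _, ⟨x, hxA, (subset_of_components hK hxK).1⟩,
        Set.inter_subset_right⟩) h₀
  refine ⟨ω, fun Y => ?_⟩
  obtain ⟨m, hm⟩ := hω Y
  -- The order of fatness grows with the index, so from index `Y.card` on, `Y` itself is an
  -- admissible set `Z`.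
  obtain ⟨K, hK, hBK, x, hxK, hxA⟩ := hA (max m Y.card) _ (hB (max m Y.card)) Y (le_max_right _ _)
  have hKs := subset_of_components hK
  have hcomp := (endComp_spec Y ω).1
  exact hmono K _ hBK (subset_component hcomp (hconn K hBK) (fun y hy => (hKs hy).2)
    ⟨x, hm _ (le_max_left _ _) ⟨hxA, (hKs hxK).1⟩, hxK⟩) (conn_of_components hcomp)

open Classical in
/-- If a member of `B` has no fat subsets of order `p`, then it contains a member `E` and a point
`b` of `E` that can be separated from all members of `B` by finite sets avoiding any given finite
set. -/
theorem exists_separable_of_not_fat (hconn : ∀ D, B D → C.Conn D) (hne : ∀ D, B D → D.Nonempty)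
    (hmono : ∀ D D', B D → D ⊆ D' → C.Conn D' → B D')
    (hsplit : ∀ D, B D → ∀ Y : Set S, Y.Finite → ∃ K ∈ C.components (D \ Y), B K)
    {p : ℕ} {D : Set S} (hD : B D) (hfat : ∀ A : Finset S, ¬ C.Fat B p D A) :
    ∃ E, B E ∧ ∃ b ∈ E, ∀ L : Finset S, (L : Set S) ⊆ E →
      ∃ Z : Finset S, Disjoint L Z ∧ ∀ K, B K → K ⊆ E \ Z → b ∉ K := by
  -- `Q R`: every finite `A` has a separator of size at most `p` that contains `R`. Such `R` have at
  -- most `p` elements, so a largest one exists.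
  let Q : Finset S → Prop := fun R => ∀ A : Finset S, ∃ Z : Finset S, R ⊆ Z ∧ Z.card ≤ p ∧
    ∀ K ∈ C.components (D \ Z), B K → ¬ (K ∩ A).Nonempty
  have hQ0 : Q ∅ := by
    intro A
    have := hfat A
    unfold Fat at this
    push Not at this
    obtain ⟨Z, hZ, h⟩ := this
    exact ⟨Z, Finset.empty_subset _, hZ, fun K hK hBK => by
      rw [h K hK hBK]; exact Set.not_nonempty_empty⟩
  have hbound : ∀ R, Q R → R.card ≤ p := fun R hR => by
    obtain ⟨Z, hRZ, hZ, -⟩ := hR ∅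
    exact (Finset.card_le_card hRZ).trans hZ
  obtain ⟨R, hR, hmax⟩ : ∃ R, Q R ∧ ∀ R', Q R' → R'.card ≤ R.card := by
    let c : ℕ → Prop := fun k => ∃ R, Q R ∧ R.card = k
    have hc := Nat.findGreatest_spec (P := c) (Nat.zero_le p) ⟨∅, hQ0, rfl⟩
    obtain ⟨R, hR, hRc⟩ := hc
    refine ⟨R, hR, fun R' hR' => ?_⟩
    rw [hRc]
    exact Nat.le_findGreatest (hbound R' hR') ⟨R', hR', rfl⟩
  obtain ⟨E, hE, hBE⟩ := hsplit D hD R R.finite_toSet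
  have hEs := subset_of_components hE
  obtain ⟨b, hb⟩ := hne E hBE
  refine ⟨E, hBE, b, hb, fun L hL => ?_⟩
  -- By maximality of `R`, each `x ∈ L` has a test set that no small separator containing `x` and
  -- `R` can handle.
  have hx : ∀ x ∈ L, ∃ A : Finset S, ∀ Z : Finset S, insert x R ⊆ Z → Z.card ≤ p →
      ∃ K ∈ C.components (D \ Z), B K ∧ (K ∩ A).Nonempty := by
    intro x hxL
    have hxR : x ∉ R := fun h => (hEs (hL hxL)).2 h
    by_contra hcon
    push Not at hcon
    have : Q (insert x R) := fun A => by
      obtain ⟨Z, h1, h2, h3⟩ := hcon A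
      exact ⟨Z, h1, h2, fun K hK hBK => by rw [h3 K hK hBK]; exact Set.not_nonempty_empty⟩
    have := hmax _ this
    rw [Finset.card_insert_of_notMem hxR] at this
    omega
  choose! A hA using hx
  -- One separator for `b` and all the test sets together: it cannot contain any `x ∈ L`, since it
  -- handles the test set of `x`.
  obtain ⟨Z, hRZ, hZp, hZ⟩ := hR (insert b (L.biUnion A))
  refine ⟨Z, ?_, ?_⟩
  · rw [Finset.disjoint_left]
    intro x hxL hxZ
    obtain ⟨K, hK, hBK, y, hyK, hyA⟩ := hA x hxL Z (Finset.insert_subset hxZ hRZ) hZp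
    exact hZ K hK hBK ⟨y, hyK, Finset.mem_coe.2 (Finset.mem_insert_of_mem
      (Finset.mem_biUnion.2 ⟨x, hxL, hyA⟩))⟩
  · intro K hBK hKs hbK
    obtain ⟨K', hK', hKK'⟩ := exists_component (A := D \ Z) (hconn K hBK)
      (fun y hy => ⟨(hEs (hKs hy).1).1, (hKs hy).2⟩) ⟨b, hbK⟩
    exact hZ K' hK' (hmono K K' hBK hKK' (conn_of_components hK'))
      ⟨b, hKK' hbK, Finset.mem_coe.2 (Finset.mem_insert_self _ _)⟩

open Classical in
/-- If a point `b` of a member `E` of `B` can be separated from all members of `B` by finite sets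
avoiding any given finite set, some end lives in members of `B` only. -/
theorem exists_end_of_separable (hconn : ∀ D, B D → C.Conn D) (hne : ∀ D, B D → D.Nonempty)
    (hmono : ∀ D D', B D → D ⊆ D' → C.Conn D' → B D')
    (hsplit : ∀ D, B D → ∀ Y : Set S, Y.Finite → ∃ K ∈ C.components (D \ Y), B K)
    {E : Set S} (hE : B E) {b : S} (hb : b ∈ E)
    (hsep : ∀ L : Finset S, (L : Set S) ⊆ E →
      ∃ Z : Finset S, Disjoint L Z ∧ ∀ K, B K → K ⊆ E \ Z → b ∉ K) :
    ∃ ω : C.End, ∀ Y : Finset S, B (C.endComp Y ω) := by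
  choose! z hzL hz using hsep
  -- `L` collects the earlier separators within `E`, so each new one is disjoint from them there.
  let next : Finset S → Finset S := fun L => L ∪ (z L).filter (· ∈ E)
  let L : ℕ → Finset S := fun n => next^[n] ∅
  have hLs : ∀ n, L (n + 1) = L n ∪ (z (L n)).filter (· ∈ E) := fun n =>
    Function.iterate_succ_apply' next n ∅
  have hLE : ∀ n, (L n : Set S) ⊆ E := by
    intro n
    induction n with
    | zero => simp [L]
    | succ n ih =>
      intro x hx
      rw [hLs] at hx
      rcases Finset.mem_union.1 (Finset.mem_coe.1 hx) with h | h
      · exact ih h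
      · exact (Finset.mem_filter.1 h).2
  have hLmono : Monotone L := monotone_nat_of_le_succ fun n => by
    rw [hLs]; exact Finset.subset_union_left
  let Z : ℕ → Finset S := fun n => z (L n)
  have hZ : ∀ x ∈ E, ∀ i j, x ∈ Z i → x ∈ Z j → i = j := by
    have key : ∀ x ∈ E, ∀ i j, i < j → x ∈ Z i → x ∉ Z j := by
      intro x hxE i j hij hxi hxj
      refine Finset.disjoint_left.1 (hzL (L j) (hLE j)) (hLmono (Nat.succ_le_of_lt hij) ?_) hxj
      rw [hLs]
      exact Finset.mem_union_right _ (Finset.mem_filter.2 ⟨hxi, hxE⟩)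
    intro x hxE i j hxi hxj
    rcases lt_trichotomy i j with h | h | h
    · exact (key x hxE i j h hxi hxj).elim
    · exact h
    · exact (key x hxE j i h hxj hxi).elim
  have hpt : ∀ D, B D → ∃ x, x ∈ D := hne
  have : Nonempty S := ⟨b⟩
  choose! pt hpt using hpt
  -- Prescribing `Z n` keeps `D (n + 1)` off `Z n`; the point `pt D` later shows that `D n` meets
  -- the component of ω.
  obtain ⟨D, hB, hDE, hstep, ω, hω⟩ := exists_descending_seq hconn hsplit
    (fun n D => insert (pt D) (↑(Z n) ∩ D))
    (fun n D hD => ⟨((Z n).finite_toSet.inter_of_left _).insert _, Set.insert_nonempty _ _,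
      Set.insert_subset (hpt D hD) Set.inter_subset_right⟩) hE
  have hanti : Antitone D := antitone_nat_of_succ_le fun n => (hstep n).trans Set.sdiff_subset
  -- A finite connected `F` in `E` joining `b` to `x` misses some `Z n`, because these are disjoint
  -- in `E`. If `x` were in `D (n + 1)`, then `D (n + 1) ∪ F` would be a member of `B` in `E \ Z n`
  -- containing `b`.
  have hout : ∀ x, ∃ n, ∀ k, n ≤ k → x ∉ D k := by
    intro x
    by_cases hxE : x ∈ E
    · obtain ⟨F, hF, hFE, hbF, hxF⟩ := hconn E hE b hb x hxE
      obtain ⟨n, hn⟩ : ∃ n, Disjoint F (Z n : Set S) := by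
        by_contra hcon
        push Not at hcon
        have : ∀ n, ∃ y ∈ F, y ∈ Z n := fun n => by
          obtain ⟨y, hy, hyZ⟩ := Set.not_disjoint_iff.1 (hcon n)
          exact ⟨y, hy, hyZ⟩
        choose y hyF hyZ using this
        have hinj : Function.Injective y := fun i j hij =>
          hZ (y i) (hFE (hyF i)) i j (hyZ i) (hij ▸ hyZ j)
        exact Set.infinite_of_injective_forall_mem hinj hyF (C.finite_of_mem F hF)
      refine ⟨n + 1, fun k hk hxk => ?_⟩
      have hx : x ∈ D (n + 1) := hanti hk hxk
      have hU : C.Conn (D (n + 1) ∪ F) := (hconn _ (hB _)).union (conn_of_mem_fam hF) ⟨x, hx, hxF⟩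
      refine hz (L n) (hLE n) _ (hmono _ _ (hB _) Set.subset_union_left hU) ?_ (Or.inr hbF)
      rintro y (hy | hy)
      · exact ⟨hDE _ hy, fun hyZ => (hstep n hy).2 (Or.inr ⟨hyZ, (hstep n hy).1⟩)⟩
      · exact ⟨hFE hy, fun hyZ => Set.disjoint_left.1 hn hy hyZ⟩
    · exact ⟨0, fun k _ hk => hxE (hDE k hk)⟩
  choose out hout using hout
  refine ⟨ω, fun Y => ?_⟩
  obtain ⟨m, hm⟩ := hω Y
  set n := max m (Y.sup out)
  have hcomp := (endComp_spec Y ω).1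
  refine hmono (D n) _ (hB n) (subset_component hcomp (hconn _ (hB n)) (fun x hx hxY => ?_)
    ⟨pt (D n), hm n (le_max_left _ _) (Set.mem_insert _ _), hpt _ (hB n)⟩)
    (conn_of_components hcomp)
  exact hout x n ((Finset.le_sup hxY).trans (le_max_right _ _)) hx

/-- Let `B` be a nonempty class of nonempty connected sets that is closed under connected
supersets and such that after deleting finitely many elements from a member some component is
again a member.  Then there is an end that lives in members of `B` only. -/
theorem exists_end_forall_endComp (hconn : ∀ D, B D → C.Conn D) (hne : ∀ D, B D → D.Nonempty)
    (hmono : ∀ D D', B D → D ⊆ D' → C.Conn D' → B D')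
    (hsplit : ∀ D, B D → ∀ Y : Set S, Y.Finite → ∃ K ∈ C.components (D \ Y), B K)
    {D₀ : Set S} (h₀ : B D₀) : ∃ ω : C.End, ∀ Y : Finset S, B (C.endComp Y ω) := by
  by_cases hfat : ∀ p D, B D → ∃ A : Finset S, C.Fat B p D A
  · exact exists_end_of_fat hconn hmono hsplit hfat h₀
  · push Not at hfat
    obtain ⟨p, D, hD, h⟩ := hfat
    obtain ⟨E, hE, b, hb, hsep⟩ := exists_separable_of_not_fat hconn hne hmono hsplit hD h
    exact exists_end_of_separable hconn hne hmono hsplit hE hb hsep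

end Connectoid

/-! ### Dismantling by deleting single elements -/

namespace Connectoid

variable {S : Type*} (C : Connectoid S) (P : Set S → Prop)

/-- The sets that can be broken up into sets satisfying `P` by deleting elements one after the
other, continuing separately in every component that arises. -/
inductive Dismantlable : Set S → Prop
  | base {D : Set S} : P D → Dismantlable D
  | step {D : Set S} (s : S) : s ∈ D → (∀ K ∈ C.components (D \ {s}), Dismantlable K) →
      Dismantlable D

variable {C P}

theorem Dismantlable.mono (hP : ∀ D D', P D → D' ⊆ D → P D') {D : Set S}
    (h : C.Dismantlable P D) : ∀ {D' : Set S}, D' ⊆ D → C.Conn D' → D'.Nonempty →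
      C.Dismantlable P D' := by
  induction h with
  | base h => exact fun hs _ _ => .base (hP _ _ h hs)
  | @step D s _ _ ih =>
    intro D' hs hD' hne
    by_cases hsD : s ∈ D'
    · refine .step s hsD fun K hK => ?_
      obtain ⟨K', hK', hKK'⟩ := exists_component (A := D \ {s}) (conn_of_components hK)
        ((subset_of_components hK).trans (Set.sdiff_subset_sdiff_left hs)) hK.1
      exact ih K' hK' hKK' (conn_of_components hK) hK.1
    · obtain ⟨K', hK', hKK'⟩ := exists_component (A := D \ {s}) hD'
        (fun x hx => ⟨hs hx, fun h => hsD (h ▸ hx)⟩) hne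
      exact ih K' hK' hKK' hD' hne

/-- Finite deletions reduce to single ones. Read contrapositively, this is the splitting hypothesis
for the class of non-dismantlable sets. -/
theorem Dismantlable.of_finite_diff (hP : ∀ D D', P D → D' ⊆ D → P D') {Y : Set S}
    (hY : Y.Finite) : ∀ {D : Set S}, C.Conn D → D.Nonempty →
      (∀ K ∈ C.components (D \ Y), C.Dismantlable P K) → C.Dismantlable P D := by
  induction Y, hY using Set.Finite.induction_on with
  | empty =>
    intro D hD hne h
    rw [Set.sdiff_empty] at h
    exact h D ⟨hne, ⟨subset_rfl, hD⟩, fun E hE _ => hE.1⟩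
  | @insert a Y _ _ ih =>
    intro D hD hne h
    refine ih hD hne fun K hK => ?_
    have hlift : ∀ K' : Set S, C.Conn K' → K'.Nonempty → K' ⊆ K → a ∉ K' →
        C.Dismantlable P K' := by
      intro K' hK' hne' hs ha
      obtain ⟨K'', hK'', hs'⟩ := exists_component (A := D \ insert a Y) hK' (fun x hx =>
        ⟨(subset_of_components hK (hs hx)).1, fun hxa => hxa.elim (fun h => ha (h ▸ hx))
          (subset_of_components hK (hs hx)).2⟩) hne'
      exact (h K'' hK'').mono hP hs' hK' hne'
    by_cases ha : a ∈ K
    · refine .step a ha fun K' hK' => hlift K' (conn_of_components hK') hK'.1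
        ((subset_of_components hK').trans Set.sdiff_subset)
        fun h => (subset_of_components hK' h).2 rfl
    · exact hlift K (conn_of_components hK) hK.1 subset_rfl ha

/-- The whole connectoid can be broken up into sets that are contained in the components
`K(X ω, ω)`. -/
theorem dismantlable_univ [Nonempty S] (hC : C.IsConnected) (X : C.End → Finset S) :
    C.Dismantlable (fun D => ∃ ω, D ⊆ C.endComp (X ω) ω) Set.univ := by
  set P : Set S → Prop := fun D => ∃ ω, D ⊆ C.endComp (X ω) ω
  have hP : ∀ D D', P D → D' ⊆ D → P D' := fun D D' ⟨ω, h⟩ h' => ⟨ω, h'.trans h⟩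
  by_contra hcon
  obtain ⟨ω, hω⟩ := exists_end_forall_endComp
    (B := fun D => C.Conn D ∧ D.Nonempty ∧ ¬ C.Dismantlable P D) (fun D h => h.1)
    (fun D h => h.2.1) (fun D D' h hs hD' => ⟨hD', h.2.1.mono hs, fun h' =>
      h.2.2 (h'.mono hP hs h.1 h.2.1)⟩) (fun D h Y hY => by
        by_contra hK
        push Not at hK
        exact h.2.2 (.of_finite_diff hP hY h.1 h.2.1 fun K hK' =>
          hK K hK' (conn_of_components hK') hK'.1)) ⟨hC, Set.univ_nonempty, hcon⟩
  exact (hω (X ω)).2.2 (.base ⟨ω, subset_rfl⟩)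

/-- Forces at least one deletion from the ground set, so that the tree will have a root. -/
theorem Dismantlable.and_ne_univ [Nonempty S] (hP : ∀ D D', P D → D' ⊆ D → P D') {D : Set S}
    (h : C.Dismantlable P D) : C.Dismantlable (fun D => P D ∧ D ≠ Set.univ) D := by
  induction h with
  | @base D h =>
    by_cases hD : D = Set.univ
    · subst hD
      obtain ⟨s⟩ := ‹Nonempty S›
      refine .step s (Set.mem_univ s) fun K hK => .base ⟨hP _ _ h (Set.subset_univ K), ?_⟩
      rintro rfl
      exact (subset_of_components hK (Set.mem_univ s)).2 rfl
    · exact .base ⟨h, hD⟩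
  | step s hs _ ih => exact .step s hs ih

/-! ### Deletion rules and the sets they produce -/

variable (C P)

/-- The rule `σ`, which names the next element to be deleted, succeeds in breaking up a set. -/
inductive Succeeds (σ : Set S → S) : Set S → Prop
  | base {D : Set S} : P D → Succeeds σ D
  | step {D : Set S} : σ D ∈ D → (∀ K ∈ C.components (D \ {σ D}), Succeeds σ K) → Succeeds σ D

/-- `K` arises from `D` by one step of breaking up according to `σ`. -/
def Child (σ : Set S → S) (D K : Set S) : Prop := ¬ P D ∧ K ∈ C.components (D \ {σ D})

/-- `K` arises from `D` by finitely many steps of breaking up according to `σ`. -/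
def Below (σ : Set S → S) : Set S → Set S → Prop := Relation.ReflTransGen (C.Child P σ)

variable {C P}

/-- Breaking up `D` consults the rule only at nonempty subsets of `D`. -/
theorem Succeeds.congr {σ τ : Set S → S} {D : Set S} (h : C.Succeeds P σ D) :
    (∀ E ⊆ D, E.Nonempty → τ E = σ E) → C.Succeeds P τ D := by
  induction h with
  | base h => exact fun _ => .base h
  | @step D hD _ ih =>
    intro he
    have hDe := he D subset_rfl ⟨_, hD⟩
    refine .step (hDe ▸ hD) fun K hK => ?_
    rw [hDe] at hK
    exact ih K hK fun E hE => he E (hE.trans ((subset_of_components hK).trans Set.sdiff_subset))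

open Classical in
theorem Dismantlable.exists_succeeds [Nonempty S] {D : Set S} (h : C.Dismantlable P D) :
    ∃ σ, C.Succeeds P σ D := by
  induction h with
  | base h => exact ⟨fun _ => Classical.arbitrary S, .base h⟩
  | @step D s hs _ ih =>
    choose! σ hσ using ih
    -- Rules for different components are glued: a nonempty set lies in at most one component, whose
    -- rule applies. `D` itself lies in none, as it contains `s`.
    let τ : Set S → S := fun E => if h : ∃ K ∈ C.components (D \ {s}), E ⊆ K then
      σ h.choose E else s
    have hτD : τ D = s := dif_neg fun ⟨K, hK, hDK⟩ => (subset_of_components hK (hDK hs)).2 rfl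
    refine ⟨τ, .step (hτD.symm ▸ hs) fun K hK => ?_⟩
    rw [hτD] at hK
    refine (hσ K hK).congr fun E hE ⟨x, hx⟩ => ?_
    have hex : ∃ K ∈ C.components (D \ {s}), E ⊆ K := ⟨K, hK, hE⟩
    have hKe : hex.choose = K := components_eq hex.choose_spec.1 hK
      ⟨x, hex.choose_spec.2 hx, hE hx⟩
    simp only [τ, dif_pos hex, hKe]

theorem Succeeds.mem {σ : Set S → S} {D : Set S} (h : C.Succeeds P σ D) (hP : ¬ P D) :
    σ D ∈ D := by
  cases h with
  | base h => exact (hP h).elim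
  | step h _ => exact h

theorem Succeeds.of_below {σ : Set S → S} {D K : Set S} (h : C.Succeeds P σ D)
    (hK : C.Below P σ D K) : C.Succeeds P σ K := by
  induction hK with
  | refl => exact h
  | tail _ hc ih =>
    cases ih with
    | base h => exact (hc.1 h).elim
    | step _ h => exact h _ hc.2

theorem Succeeds.acc {σ : Set S → S} {D : Set S} (h : C.Succeeds P σ D) :
    Acc (fun K D => C.Child P σ D K) D := by
  induction h with
  | base h => exact ⟨_, fun K hK => (hK.1 h).elim⟩
  | step _ _ ih => exact ⟨_, fun K hK => ih K hK.2⟩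

section Below

variable {σ : Set S → S} {D E K K' : Set S}

theorem Child.subset (h : C.Child P σ D K) : K ⊆ D \ {σ D} := subset_of_components h.2

theorem Below.subset (h : C.Below P σ D K) : K ⊆ D := by
  induction h with
  | refl => exact subset_rfl
  | tail _ hc ih => exact (hc.subset.trans Set.sdiff_subset).trans ih

theorem Below.conn (h : C.Below P σ D K) (hD : C.Conn D) : C.Conn K := by
  cases h with
  | refl => exact hD
  | tail _ hc => exact conn_of_components hc.2

theorem Below.notMem_of_ne (h : C.Below P σ D K) (hne : K ≠ D) : σ D ∉ K := by
  obtain rfl | ⟨K', hc, hb⟩ := Relation.ReflTransGen.cases_head h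
  · exact (hne rfl).elim
  · exact fun hs => (hc.subset (Below.subset hb hs)).2 rfl

/-- The sets that arise are laminar: two descents sharing an element choose the same component until
one of them stops. -/
theorem Below.total (h : C.Below P σ D K) (h' : C.Below P σ D K') (hne : (K ∩ K').Nonempty) :
    C.Below P σ K K' ∨ C.Below P σ K' K := by
  induction h using Relation.ReflTransGen.head_induction_on with
  | refl => exact Or.inl h'
  | @head D E hc hb ih =>
    obtain rfl | ⟨E', hc', hb'⟩ := Relation.ReflTransGen.cases_head h'
    · exact Or.inr (.head hc hb)
    · obtain ⟨x, hx, hx'⟩ := hne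
      have : E = E' := components_eq hc.2 hc'.2 ⟨x, Below.subset hb hx, Below.subset hb' hx'⟩
      exact ih (this ▸ hb')

end Below

/-! ### The tree of deleted elements -/

/-- The rule `σ` breaks up the ground set, and it has to delete at least one element. -/
structure IsWinning (C : Connectoid S) (P : Set S → Prop) (σ : Set S → S) : Prop where
  succeeds : C.Succeeds P σ Set.univ
  not_univ : ¬ P Set.univ
  connected : C.IsConnected

variable (C P) in
/-- The elements that are deleted when the ground set is broken up according to `σ`. -/
def deleted (σ : Set S → S) : Set S := {v | ∃ D, C.Below P σ Set.univ D ∧ ¬ P D ∧ σ D = v}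

/-- The set from which an element is deleted. -/
noncomputable def position {σ : Set S → S} (v : C.deleted P σ) : Set S := v.2.choose

variable {σ : Set S → S}

theorem below_position (v : C.deleted P σ) : C.Below P σ Set.univ (position v) :=
  v.2.choose_spec.1

theorem not_position (v : C.deleted P σ) : ¬ P (position v) := v.2.choose_spec.2.1

theorem apply_position (v : C.deleted P σ) : σ (position v) = v := v.2.choose_spec.2.2

theorem position_injective : Function.Injective (position (C := C) (P := P) (σ := σ)) :=
  fun u v h => Subtype.ext (by rw [← apply_position u, ← apply_position v, h])

variable (C P) in
/-- The graph in which the element deleted from a set is joined to the elements deleted next from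
the arising components. -/
noncomputable def deletionGraph (σ : Set S → S) : SimpleGraph (C.deleted P σ) :=
  SimpleGraph.fromRel fun u v => C.Child P σ (position u) (position v)

namespace IsWinning

variable (h : C.IsWinning P σ)
include h

theorem mem {D : Set S} (hD : C.Below P σ Set.univ D) (hP : ¬ P D) : σ D ∈ D :=
  (h.succeeds.of_below hD).mem hP

theorem mem_position (v : C.deleted P σ) : (v : S) ∈ position v := by
  have := h.mem (below_position v) (not_position v)
  rwa [apply_position v] at this

/-- By laminarity the two sets are nested, and an element once deleted never reappears in a set
strictly below. -/
theorem eq_of_apply_eq {D E : Set S} (hD : C.Below P σ Set.univ D) (hE : C.Below P σ Set.univ E)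
    (hPD : ¬ P D) (hPE : ¬ P E) (he : σ D = σ E) : D = E := by
  have h1 := h.mem hD hPD
  have h2 := h.mem hE hPE
  by_contra hne
  rcases hD.total hE ⟨σ D, h1, he ▸ h2⟩ with hb | hb
  · exact hb.notMem_of_ne (Ne.symm hne) (he ▸ h2)
  · exact hb.notMem_of_ne hne (he ▸ h1)

theorem exists_position_eq {D : Set S} (hD : C.Below P σ Set.univ D) (hP : ¬ P D) :
    ∃ v : C.deleted P σ, position v = D := by
  let v : C.deleted P σ := ⟨σ D, D, hD, hP, rfl⟩
  exact ⟨v, h.eq_of_apply_eq (below_position v) hD (not_position v) hP (apply_position v)⟩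

theorem parent_unique {D E K : Set S} (hD : C.Below P σ Set.univ D)
    (hE : C.Below P σ Set.univ E) (hDK : C.Child P σ D K) (hEK : C.Child P σ E K) : D = E := by
  have key : ∀ D E : Set S, C.Below P σ Set.univ E → C.Child P σ D K → C.Child P σ E K →
      C.Below P σ D E → D = E := by
    intro D E hE hDK hEK hb
    obtain rfl | ⟨K', hc, hb'⟩ := Relation.ReflTransGen.cases_head hb
    · rfl
    -- Here `E` lies in a component of `D \ {σ D}` that meets `K`, hence in `K`; but `K` omits `σ E
    -- ∈ E`.
    · have hKE : K ⊆ E := hEK.subset.trans Set.sdiff_subset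
      obtain ⟨x, hx⟩ := hDK.2.1
      have hKK' : K = K' := components_eq hDK.2 hc.2 ⟨x, hx, Below.subset hb' (hKE hx)⟩
      have hEK' : E ⊆ K := hKK' ▸ Below.subset hb'
      exact ((hEK.subset (hEK' (h.mem hE hEK.1))).2 rfl).elim
  obtain ⟨x, hx⟩ := hDK.2.1
  rcases hD.total hE ⟨x, (hDK.subset hx).1, (hEK.subset hx).1⟩ with hb | hb
  · exact key D E hE hDK hEK hb
  · exact (key E D hD hEK hDK hb).symm

theorem ne_of_child {u v : C.deleted P σ} (hc : C.Child P σ (position u) (position v)) :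
    u ≠ v := by
  rintro rfl
  have := h.mem_position u
  exact (hc.subset this).2 (apply_position u).symm

theorem not_below_of_child {u v : C.deleted P σ}
    (hc : C.Child P σ (position u) (position v)) : ¬ C.Below P σ (position v) (position u) :=
  fun hb => (hc.subset (hb.subset (h.mem_position u))).2 (apply_position u).symm

/-- Every edge is a bridge: the only edge leaving the part below a vertex goes to its unique parent.
-/
theorem isAcyclic : (C.deletionGraph P σ).IsAcyclic := by
  rw [SimpleGraph.isAcyclic_iff_forall_adj_isBridge]
  have key : ∀ v w : C.deleted P σ, C.Child P σ (position v) (position w) →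
      (C.deletionGraph P σ).IsBridge s(v, w) := by
    intro v w hc
    rw [SimpleGraph.isBridge_iff]
    rintro ⟨p⟩
    -- Without the edge `vw`, a walk ending below `w` stays below `w` when traced backwards.
    have hinv : ∀ {a b : C.deleted P σ},
        ((C.deletionGraph P σ).deleteEdges {s(v, w)}).Walk a b →
        C.Below P σ (position w) (position b) → C.Below P σ (position w) (position a) := by
      intro a b p
      induction p with
      | nil => exact id
      | @cons a c b hac p ih =>
        intro hb
        have hwc := ih hb
        rw [SimpleGraph.deleteEdges_adj, deletionGraph, SimpleGraph.fromRel_adj] at hac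
        obtain ⟨⟨-, hac | hac⟩, hne⟩ := hac
        · obtain he | ⟨D, hwD, hDc⟩ := Relation.ReflTransGen.cases_tail hwc
          · have hcw : c = w := position_injective he
            subst hcw
            have hav : a = v := position_injective
              (h.parent_unique (below_position a) (below_position v) hac hc)
            exact (hne (by rw [hav]; rfl)).elim
          · have : position a = D := h.parent_unique (below_position a)
              ((below_position w).trans hwD) hac hDc
            rw [this]
            exact hwD
        · exact hwc.tail hac
    exact h.not_below_of_child hc (hinv p .refl)
  intro v w hvw
  rw [deletionGraph, SimpleGraph.fromRel_adj] at hvw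
  rcases hvw.2 with hc | hc
  · exact key v w hc
  · rw [Sym2.eq_swap]
    exact key w v hc

/-- The support clause identifies the tree order with `Below`, and shows that a vertex has only
finitely many predecessors. -/
theorem exists_isPath {r : C.deleted P σ} (hr : position r = Set.univ) (v : C.deleted P σ) :
    ∃ p : (C.deletionGraph P σ).Walk r v, p.IsPath ∧
      ∀ u, u ∈ p.support ↔ C.Below P σ (position u) (position v) := by
  suffices H : ∀ D, C.Below P σ Set.univ D → ∀ v : C.deleted P σ, position v = D →
      ∃ p : (C.deletionGraph P σ).Walk r v, p.IsPath ∧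
        ∀ u, u ∈ p.support ↔ C.Below P σ (position u) (position v) from
    H _ (below_position v) v rfl
  intro D hD
  induction hD with
  | refl =>
    intro v hv
    obtain rfl : r = v := position_injective (hr.trans hv.symm)
    refine ⟨.nil, .nil, fun u => ?_⟩
    rw [SimpleGraph.Walk.support_nil, List.mem_singleton]
    refine ⟨fun hu => hu ▸ .refl, fun hb => position_injective ?_⟩
    rw [hr] at hb ⊢
    exact Set.univ_subset_iff.1 hb.subset
  | @tail D E hD hc ih =>
    rintro v rfl
    obtain ⟨w, rfl⟩ := h.exists_position_eq hD hc.1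
    obtain ⟨p, hp, hsupp⟩ := ih w rfl
    have hadj : (C.deletionGraph P σ).Adj w v :=
      (SimpleGraph.fromRel_adj _ _ _).2 ⟨h.ne_of_child hc, Or.inl hc⟩
    refine ⟨p.concat hadj, hp.concat (fun hv => h.not_below_of_child hc ((hsupp v).1 hv)) hadj,
      fun u => ?_⟩
    rw [SimpleGraph.Walk.support_concat, List.mem_append,
      List.mem_singleton, hsupp]
    constructor
    · rintro (hb | rfl)
      · exact hb.tail hc
      · exact .refl
    · intro hb
      obtain he | ⟨D, huD, hDv⟩ := Relation.ReflTransGen.cases_tail hb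
      · exact Or.inr (position_injective he.symm)
      · rw [h.parent_unique (below_position w) ((below_position u).trans huD) hc hDv]
        exact Or.inl huD

theorem exists_root : ∃ r : C.deleted P σ, position r = Set.univ :=
  h.exists_position_eq .refl h.not_univ

theorem isTree : (C.deletionGraph P σ).IsTree := by
  obtain ⟨r, hr⟩ := h.exists_root
  have : Nonempty (C.deleted P σ) := ⟨r⟩
  refine ⟨⟨fun u v => ?_⟩, h.isAcyclic⟩
  obtain ⟨p, -⟩ := h.exists_isPath hr u
  obtain ⟨q, -⟩ := h.exists_isPath hr v
  exact ⟨p.reverse.append q⟩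

/-- The rooted tree of deleted elements. -/
noncomputable def tree : RootedTreeOn S where
  verts := C.deleted P σ
  graph := C.deletionGraph P σ
  isTree := h.isTree
  root := h.exists_root.choose

theorem le_iff {u v : C.deleted P σ} :
    h.tree.le u v ↔ C.Below P σ (position u) (position v) := by
  obtain ⟨p, hp, hsupp⟩ := h.exists_isPath h.exists_root.choose_spec v
  refine ⟨?_, fun hb => ⟨p, hp, (hsupp u).2 hb⟩⟩
  rintro ⟨q, hq, hu⟩
  have hqp : q = p := congrArg Subtype.val
    ((h.isAcyclic.subsingleton_path _ _).elim (⟨q, hq⟩ : SimpleGraph.Path _ _ _) ⟨p, hp⟩)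
  rw [hqp] at hu
  exact (hsupp u).1 hu

theorem rayless : h.tree.Rayless := by
  rintro (R : ℕ → C.deleted P σ) ⟨hinj, hadj⟩
  replace hadj : ∀ n, C.Child P σ (position (R n)) (position (R (n + 1))) ∨
      C.Child P σ (position (R (n + 1))) (position (R n)) :=
    fun n => ((SimpleGraph.fromRel_adj _ _ _).1 (hadj n)).2
  -- After one downward step the ray can never turn up, since unique parents would make it
  -- backtrack; this contradicts accessibility. A ray that never steps down runs through infinitely
  -- many predecessors of `R 0`.
  by_cases hdown : ∃ n, C.Child P σ (position (R n)) (position (R (n + 1)))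
  · obtain ⟨n, hn⟩ := hdown
    have hall : ∀ k, C.Child P σ (position (R (n + k))) (position (R (n + k + 1))) := by
      intro k
      induction k with
      | zero => exact hn
      | succ k ih =>
        refine (hadj (n + k + 1)).resolve_right fun hup => ?_
        have := hinj (position_injective
          (h.parent_unique (below_position _) (below_position _) ih hup))
        omega
    have hacc : ∀ D, Acc (fun K D => C.Child P σ D K) D → ∀ k, position (R (n + k)) ≠ D := by
      intro D hD
      induction hD with
      | intro D _ ih =>
        rintro k rfl
        exact ih _ (hall k) (k + 1) rfl
    exact hacc _ (h.succeeds.of_below (below_position _)).acc 0 rfl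
  · push Not at hdown
    have hup := fun n => (hadj n).resolve_left (hdown n)
    have hb : ∀ n, C.Below P σ (position (R n)) (position (R 0)) := by
      intro n
      induction n with
      | zero => exact .refl
      | succ n ih => exact .head (hup n) ih
    obtain ⟨p, -, hsupp⟩ := h.exists_isPath h.exists_root.choose_spec (R 0)
    exact Set.infinite_of_injective_forall_mem hinj (fun n => (hsupp (R n)).2 (hb n))
      p.support.finite_toSet

/-- The first element of `A` to be deleted works: until then `A` stays inside a single component, so
the descents to `u` and to `v` coincide. -/
theorem exists_common_le {A : Set S} (hA : C.Conn A) {u v : C.deleted P σ} (hu : (u : S) ∈ A)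
    (hv : (v : S) ∈ A) : ∃ w : C.deleted P σ, (w : S) ∈ A ∧
      C.Below P σ (position w) (position u) ∧ C.Below P σ (position w) (position v) := by
  suffices H : ∀ D, Acc (fun K D => C.Child P σ D K) D → C.Below P σ Set.univ D → A ⊆ D →
      C.Below P σ D (position u) → C.Below P σ D (position v) → ∃ w : C.deleted P σ, (w : S) ∈ A ∧
        C.Below P σ (position w) (position u) ∧ C.Below P σ (position w) (position v) from
    H _ h.succeeds.acc .refl (Set.subset_univ A) (below_position u) (below_position v)
  intro D hD
  induction hD with
  | intro D _ ih =>
    intro hD hAD hDu hDv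
    have hPD : ¬ P D := by
      obtain he | ⟨K, hc, -⟩ := Relation.ReflTransGen.cases_head hDu
      · exact he ▸ not_position u
      · exact hc.1
    obtain ⟨w, rfl⟩ := h.exists_position_eq hD hPD
    by_cases hw : (w : S) ∈ A
    · exact ⟨w, hw, hDu, hDv⟩
    obtain ⟨K, hK, hAK⟩ := exists_component (A := position w \ {σ (position w)}) hA
      (fun x hx => ⟨hAD hx, fun hxw => hw (by
        rw [apply_position w, Set.mem_singleton_iff] at hxw; exact hxw ▸ hx)⟩) ⟨_, hu⟩
    have hchild : C.Child P σ (position w) K := ⟨hPD, hK⟩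
    have hnext : ∀ y : C.deleted P σ, (y : S) ∈ A → C.Below P σ (position w) (position y) →
        C.Below P σ K (position y) := by
      intro y hy hb
      obtain he | ⟨K', hc', hb'⟩ := Relation.ReflTransGen.cases_head hb
      · exact (hw (position_injective he ▸ hy)).elim
      · have : K = K' := components_eq hK hc'.2
          ⟨y, hAK hy, Below.subset hb' (h.mem_position y)⟩
        exact this ▸ hb'
    exact ih K hchild (hD.tail hchild) hAK (hnext u hu hDu) (hnext v hv hDv)

theorem isNormalTree : C.IsNormalTree h.tree where
  incomparable A hA u v hu hv _ _ := by
    obtain ⟨w, hw, h1, h2⟩ := h.exists_common_le hA hu hv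
    exact ⟨w, hw, h.le_iff.2 h1, h.le_iff.2 h2⟩
  comparable u v huv := by
    -- All strict predecessors of `u` were deleted before `position u` arose, while `v` still lies
    -- in it.
    refine ⟨position u, (below_position u).conn h.connected, h.mem_position u,
      (h.le_iff.1 huv).subset (h.mem_position v), fun w hwu hne => ?_⟩
    have := (h.le_iff.1 hwu).notMem_of_ne fun he => hne (position_injective he).symm
    rwa [apply_position w] at this
  ray R hR _ := (h.rayless R hR).elim

/-- No deletion touches `K`, so `K` passes whole into one component at each step, until the descent
stops at a set satisfying `P`. -/
theorem exists_of_component {K : Set S} (hK : K ∈ C.components (C.deleted P σ)ᶜ) :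
    ∃ D, P D ∧ K ⊆ D := by
  suffices H : ∀ D, Acc (fun K D => C.Child P σ D K) D → C.Below P σ Set.univ D → K ⊆ D →
      ∃ D, P D ∧ K ⊆ D from H _ h.succeeds.acc .refl (Set.subset_univ K)
  intro D hD
  induction hD with
  | intro D _ ih =>
    intro hD hKD
    by_cases hP : P D
    · exact ⟨D, hP, hKD⟩
    obtain ⟨K', hK', hKK'⟩ := exists_component (A := D \ {σ D}) (conn_of_components hK)
      (fun x hx => ⟨hKD hx, fun hxs => subset_of_components hK hx ⟨D, hD, hP, hxs.symm⟩⟩) hK.1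
    exact ih K' ⟨hP, hK'⟩ (hD.tail ⟨hP, hK'⟩) hKK'

end IsWinning

end Connectoid

/-- Let `C` be a connected connectoid on a nonempty set `S` and choose for every end `ω` a finite
set `X ω`.  Then there is a rayless normal tree `T` such that every component of the complement of
the vertex set of `T` is contained in `K(X ω, ω)` for some end `ω`. -/
theorem theorem1p3 {S : Type*} [Nonempty S] (C : Connectoid S) (hC : C.IsConnected)
    (X : C.End → Finset S) :
    ∃ T : RootedTreeOn S, C.IsNormalTree T ∧ T.Rayless ∧
      ∀ K ∈ C.components T.vertsᶜ, ∃ ω : C.End, K ⊆ C.endComp (X ω) ω := by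
  obtain ⟨σ, hσ⟩ := ((Connectoid.dismantlable_univ hC X).and_ne_univ
    fun D D' ⟨ω, h⟩ h' => ⟨ω, h'.trans h⟩).exists_succeeds
  have h : C.IsWinning _ σ := ⟨hσ, fun h => h.2 rfl, hC⟩
  refine ⟨h.tree, h.isNormalTree, h.rayless, fun K hK => ?_⟩
  obtain ⟨D, ⟨⟨ω, hω⟩, -⟩, hKD⟩ := h.exists_of_component hK
  exact ⟨ω, hKD.trans hω⟩
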